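/- Consider a server with $N\ge 1$ independent files $W_1,\dots,W_N$, each uniformly distributed over a set of size $2^F$, and $K\ge 1$ users, where user $k$ has a cache of $M_kF$ bits and $0\le M_1\le M_2\le\cdots\le M_K<N$. A caching and delivery code with delivery rate $R$ consists of placement functions $Z_k=\phi_k(W_1,\dots,W_N)$ taking at most $2^{M_kF}$ values, an encoding function $X=\psi(W_1,\dots,W_N,d_1,\dots,d_K)$ taking at most $2^{RF}$ values, where $d_k\in\{1,\dots,N\}$ is the demand of user $k$, and decoding functions $\hat W_{d_k}=\rho_k(Z_k,X,d_1,\dots,d_K)$. Its error probability is $P_e=\max_{(d_1,\dots,d_K)}\Pr\{\hat W_{d_k}\ne W_{d_k}\text{ for some }k\}$. The pair $(M_1,\dots,M_K;R)$ is achievable if for every $\varepsilon>0$ and all sufficiently large $F$ there is such a code with $P_e<\varepsilon$. Let $R^*$ be the optimal worst-case delivery rate, i.e. the infimum of all $R$ such that $(M_1,\dots,M_K;R)$ is achievable. Then the set of these $R$ is nonempty and bounded below, so that $R^*$ is a well-defined real number, and $$R^*\ \ge\ \max_{\substack{1\le s\le K\\ 1\le l\le\lceil N/s\rceil}}\ \frac1l\left\{N-\frac{s}{s+\gamma}\sum_{i=1}^{s+\gamma}M_i-\frac{\gamma\,(N-ls)^+}{s+\gamma}-(N-Kl)^+\right\},$$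 where $\gamma=\min\{(\lceil N/l\rceil-s)^+,\,K-s\}$ and $(x)^+=\max\{x,0\}$. -/

import Mathlib

open MeasureTheory Filter

noncomputable section

namespace CodedCaching

/-- A library of `N` files, each of them an element of a set of size `2 ^ F` (that is, `F` bits). -/
abbrev Library (N F : ℕ) : Type := Fin N → Fin (2 ^ F)

/-- A demand combination: user `k` requests the file `d k`. -/
abbrev Demand (N K : ℕ) : Type := Fin K → Fin N

/-- The law of the library: the files are independent and uniform over the set of size `2 ^ F`. -/
def libraryLaw (N F : ℕ) : Measure (Library N F) :=
  Measure.pi fun _ : Fin N => (PMF.uniformOfFintype (Fin (2 ^ F))).toMeasure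

/-- A caching and delivery code for `N` files of `F` bits and `K` users, with cache capacities
`M k * F` bits and delivery rate `R`. A quantity of `b` bits, for a real number `b`, takes at most
`2 ^ b` values. -/
structure Code (N K F : ℕ) (M : Fin K → ℝ) (R : ℝ) where
  /-- the placement function of each user -/
  cache : (k : Fin K) → Library N F → Fin ⌊(2 : ℝ) ^ (M k * F)⌋₊
  /-- the function that produces the common message -/
  encode : Library N F → Demand N K → Fin ⌊(2 : ℝ) ^ (R * F)⌋₊
  /-- the decoding function of each user -/
  decode : (k : Fin K) → Fin ⌊(2 : ℝ) ^ (M k * F)⌋₊ → Fin ⌊(2 : ℝ) ^ (R * F)⌋₊ →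
    Demand N K → Fin (2 ^ F)

/-- The event that, under the demand combination `d`, some user fails to recover its file. -/
def Code.errorEvent {N K F : ℕ} {M : Fin K → ℝ} {R : ℝ} (c : Code N K F M R)
    (d : Demand N K) : Set (Library N F) :=
  {W | ∃ k, c.decode k (c.cache k W) (c.encode W d) d ≠ W (d k)}

/-- The error probability: the maximum over all demand combinations (a finite family) of the
probability that some user fails to recover its file. -/
def Code.errorProb {N K F : ℕ} {M : Fin K → ℝ} {R : ℝ} (c : Code N K F M R) : ℝ :=
  ⨆ d : Demand N K, (libraryLaw N F).real (c.errorEvent d)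

/-- The tuple `(M, R)` is achievable: for every `ε > 0` and every sufficiently large `F` there is
a code of error probability less than `ε`. -/
def Achievable (N : ℕ) {K : ℕ} (M : Fin K → ℝ) (R : ℝ) : Prop :=
  ∀ ε : ℝ, 0 < ε → ∀ᶠ F : ℕ in atTop, ∃ c : Code N K F M R, c.errorProb < ε

/-- The optimal worst-case delivery rate. -/
def optimalRate (N : ℕ) {K : ℕ} (M : Fin K → ℝ) : ℝ :=
  sInf {R : ℝ | Achievable N M R}

/-- `min ((⌈N / l⌉ - s)⁺, K - s)`, for `s ≤ K`; the subtractions are those of natural numbers. -/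
def gamma (N K s l : ℕ) : ℕ :=
  min (⌈(N : ℝ) / l⌉₊ - s) (K - s)

/-- The expression that is maximized in the lower bound. The sum is over the first
`s + gamma N K s l` users. -/
def boundTerm (N : ℕ) {K : ℕ} (M : Fin K → ℝ) (s l : ℕ) : ℝ :=
  let γ := gamma N K s l
  1 / (l : ℝ) *
    ((N : ℝ) - (s : ℝ) / (s + γ) * (∑ i : Fin K with i.val < s + γ, M i)
      - (γ : ℝ) * max ((N : ℝ) - l * s) 0 / (s + γ)
      - max ((N : ℝ) - K * l) 0)

/-- The pairs `(s, l)` with `1 ≤ s ≤ K` and `1 ≤ l ≤ ⌈N / s⌉`. -/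
def boundIndices (N K : ℕ) : Finset (Σ _ : ℕ, ℕ) :=
  (Finset.Icc 1 K).sigma fun s => Finset.Icc 1 ⌈(N : ℝ) / s⌉₊

theorem boundIndices_nonempty {N K : ℕ} (hN : 1 ≤ N) (hK : 1 ≤ K) :
    (boundIndices N K).Nonempty := by
  refine ⟨⟨1, 1⟩, ?_⟩
  simp [boundIndices, hN, hK]

/-- The lower bound: the maximum of `boundTerm` over the admissible pairs `(s, l)`. -/
def lowerBoundRate (N : ℕ) {K : ℕ} (hN : 1 ≤ N) (hK : 1 ≤ K) (M : Fin K → ℝ) : ℝ :=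
  (boundIndices N K).sup' (boundIndices_nonempty hN hK) fun p => boundTerm N M p.1 p.2

end CodedCaching

end

/-! Call a library good if every demand is served without error. Once the error probability is
small, a union bound over the finitely many demands makes at least half of all libraries good
(`Code.card_good_ge`). Under the uniform law on good libraries decoding is exact, so Fano's
inequality is not needed, and the lost factor 2 disappears as F → ∞.

Among the first n = s + γ users take the n cyclic windows of s users. With rotated demands, l
transmissions X_j let the caches S_j of each window decode the same files A, those of index below
sl, and let all n caches Z decode the files of index below nl. With U the files beyond nl,
submodularity gives H(all) ≤ H(S_j, X_j) + H(Z | S_j, A) + H(U). Summed over j, each cache counts s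
times, and Shearer's inequality (`Setoid.entropy_window`) bounds ∑_j H(Z | S_j, A) by (n - s) H(Z |
A), hence by (n - s) H(B), where B is the files outside A. This is `Setoid.log_card_le_of_windows`;
normalising by n, l and F gives the bound. Sending the whole library shows that the infimum is over
a nonempty set. -/

/-! ### Entropy of partitions of a finite uniform space. -/

open scoped Classical in
/-- The number of points equivalent to `x`. -/
noncomputable def Setoid.classCard {Ω : Type*} [Fintype Ω] (r : Setoid Ω) (x : Ω) : ℕ :=
  (Finset.univ.filter fun y => r y x).card

/-- The Shannon entropy (in nats) of the partition of a finite type into the classes of `r`, for the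
uniform law. The entropy of `Setoid.ker f` is that of the random variable `f`, and the infimum of
setoids corresponds to joint random variables. -/
noncomputable def Setoid.entropy {Ω : Type*} [Fintype Ω] (r : Setoid Ω) : ℝ :=
  Real.log (Fintype.card Ω) - (∑ x, Real.log (r.classCard x)) / Fintype.card Ω

namespace Setoid

variable {Ω : Type*} [Fintype Ω]

theorem classCard_pos (r : Setoid Ω) (x : Ω) : 0 < r.classCard x := by
  classical
  exact Finset.card_pos.2 ⟨x, by simp⟩

theorem classCard_mono {r t : Setoid Ω} (h : r ≤ t) (x : Ω) : r.classCard x ≤ t.classCard x := by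
  classical
  exact Finset.card_le_card fun y hy => by
    simp only [Finset.mem_filter, Finset.mem_univ, true_and] at hy ⊢
    exact h hy

theorem classCard_congr (r : Setoid Ω) {x y : Ω} (h : r x y) : r.classCard x = r.classCard y := by
  classical
  unfold classCard
  congr 1
  ext z
  simp only [Finset.mem_filter, Finset.mem_univ, true_and]
  exact ⟨fun hz => r.trans hz h, fun hz => r.trans hz (r.symm h)⟩

/-- `S` lies in a single class, so each summand is at most 1/|S|. -/
theorem sum_inv_classCard_le_one (r : Setoid Ω) (S : Finset Ω)
    (hS : ∀ x ∈ S, ∀ y ∈ S, r x y) : ∑ x ∈ S, ((r.classCard x : ℝ))⁻¹ ≤ 1 := by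
  classical
  rcases S.eq_empty_or_nonempty with rfl | hne
  · simp
  have hc : (0 : ℝ) < S.card := by exact_mod_cast hne.card_pos
  calc ∑ x ∈ S, ((r.classCard x : ℝ))⁻¹ ≤ ∑ _x ∈ S, ((S.card : ℝ))⁻¹ := by
        refine Finset.sum_le_sum fun x hx => inv_anti₀ hc ?_
        have : S.card ≤ r.classCard x := Finset.card_le_card fun y hy => by
          simpa using hS y hy x hx
        exact_mod_cast this
    _ = 1 := by
        rw [Finset.sum_const, nsmul_eq_mul, mul_inv_cancel₀ hc.ne']

theorem entropy_anti {r t : Setoid Ω} (h : r ≤ t) : t.entropy ≤ r.entropy := by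
  unfold entropy
  gcongr with x
  · exact_mod_cast r.classCard_pos x
  · exact classCard_mono h x

theorem entropy_bot : (⊥ : Setoid Ω).entropy = Real.log (Fintype.card Ω) := by
  classical
  have : ∀ x, (⊥ : Setoid Ω).classCard x = 1 := fun x => by
    simp only [classCard, Setoid.bot_def]
    rw [Finset.filter_eq' Finset.univ x, if_pos (Finset.mem_univ x), Finset.card_singleton]
  simp [entropy, this]

theorem entropy_top [Nonempty Ω] : (⊤ : Setoid Ω).entropy = 0 := by
  classical
  have : ∀ x, (⊤ : Setoid Ω).classCard x = Fintype.card Ω := fun x => by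
    simp [classCard, Setoid.top_def]
  have h : (Fintype.card Ω : ℝ) ≠ 0 := by exact_mod_cast Fintype.card_ne_zero
  simp [entropy, this, h]

theorem entropy_ker_le [Nonempty Ω] {α : Type*} [Fintype α] (f : Ω → α) :
    (ker f).entropy ≤ Real.log (Fintype.card α) := by
  classical
  have hΩ : (0 : ℝ) < Fintype.card Ω := by exact_mod_cast Fintype.card_pos
  have : Nonempty α := ⟨f (Classical.arbitrary Ω)⟩
  have hα : (0 : ℝ) < Fintype.card α := by exact_mod_cast Fintype.card_pos
  have hn : ∀ x, (0 : ℝ) < (ker f).classCard x := fun x => by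
    exact_mod_cast (ker f).classCard_pos x
  have hinv : ∑ x, (((ker f).classCard x : ℝ))⁻¹ ≤ Fintype.card α := by
    rw [← Finset.sum_fiberwise Finset.univ f]
    calc _ ≤ ∑ _a : α, (1 : ℝ) := Finset.sum_le_sum fun a _ =>
          sum_inv_classCard_le_one _ _ fun x hx y hy => by
            simp only [Finset.mem_filter, Finset.mem_univ, true_and] at hx hy
            exact hx.trans hy.symm
      _ = _ := by simp
  -- Gibbs' inequality, from log t ≤ t - 1 at each point.
  have key : ∑ x : Ω, (Real.log (Fintype.card Ω) - Real.log (Fintype.card α)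
      - Real.log ((ker f).classCard x)) ≤ 0 := by
    calc _ ≤ ∑ x : Ω, ((Fintype.card Ω : ℝ) / Fintype.card α *
          (((ker f).classCard x : ℝ))⁻¹ - 1) := by
          refine Finset.sum_le_sum fun x _ => ?_
          rw [← Real.log_div hΩ.ne' hα.ne', ← Real.log_div (by positivity) (hn x).ne',
            ← div_eq_mul_inv]
          exact Real.log_le_sub_one_of_pos (div_pos (by positivity) (hn x))
      _ = (Fintype.card Ω : ℝ) / Fintype.card α * ∑ x, (((ker f).classCard x : ℝ))⁻¹
          - Fintype.card Ω := by
          rw [Finset.sum_sub_distrib, ← Finset.mul_sum]; simp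
      _ ≤ (Fintype.card Ω : ℝ) / Fintype.card α * Fintype.card α - Fintype.card Ω := by
          gcongr
      _ = 0 := by field_simp; ring
  rw [Finset.sum_sub_distrib, Finset.sum_const, nsmul_eq_mul, Finset.card_univ] at key
  unfold entropy
  rw [sub_le_comm, le_div_iff₀ hΩ]
  linarith

/-- Conditionally on `t`, the joint entropy is at most the sum of the entropies. -/
theorem entropy_submodular (r s t : Setoid Ω) :
    (r ⊓ s ⊓ t).entropy + t.entropy ≤ (r ⊓ t).entropy + (s ⊓ t).entropy := by
  classical
  rcases isEmpty_or_nonempty Ω with hE | hne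
  · simp [entropy]
  have hΩ : (0 : ℝ) < Fintype.card Ω := by exact_mod_cast Fintype.card_pos
  have hp : ∀ (r : Setoid Ω) x, (0 : ℝ) < r.classCard x := fun r x => by
    exact_mod_cast r.classCard_pos x
  have hcard : ∀ (r : Setoid Ω) x, (r.classCard x : ℝ) = ∑ y, if r y x then (1 : ℝ) else 0 :=
    fun r x => by simp [classCard]
  -- This is the total mass bound to which log t ≤ t - 1 reduces the claim. Expanding the class
  -- sizes turns it into a count of triples (a, b, x).
  have hsum : ∑ x, ((r ⊓ t).classCard x : ℝ) * (s ⊓ t).classCard x *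
      (((r ⊓ s ⊓ t).classCard x : ℝ)⁻¹ * (t.classCard x : ℝ)⁻¹) ≤ Fintype.card Ω := by
    calc _ = ∑ x, ∑ a, ∑ b, (if (r ⊓ t) a x then (1 : ℝ) else 0) *
          (if (s ⊓ t) b x then (1 : ℝ) else 0) *
          (((r ⊓ s ⊓ t).classCard x : ℝ)⁻¹ * (t.classCard x : ℝ)⁻¹) := by
          refine Finset.sum_congr rfl fun x _ => ?_
          rw [hcard (r ⊓ t), hcard (s ⊓ t), Finset.sum_mul_sum, Finset.sum_mul]
          exact Finset.sum_congr rfl fun a _ => by rw [Finset.sum_mul]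
      _ = ∑ a, ∑ b, ∑ x, (if (r ⊓ t) a x then (1 : ℝ) else 0) *
          (if (s ⊓ t) b x then (1 : ℝ) else 0) *
          (((r ⊓ s ⊓ t).classCard x : ℝ)⁻¹ * (t.classCard x : ℝ)⁻¹) := by
          rw [Finset.sum_comm]
          exact Finset.sum_congr rfl fun a _ => Finset.sum_comm
      _ ≤ ∑ a, ∑ b, (if t b a then (1 : ℝ) else 0) * (t.classCard a : ℝ)⁻¹ := by
          refine Finset.sum_le_sum fun a _ => Finset.sum_le_sum fun b _ => ?_
          by_cases hab : t b a
          · rw [if_pos hab, one_mul]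
            calc _ = ∑ x ∈ Finset.univ.filter (fun x => (r ⊓ t) a x ∧ (s ⊓ t) b x),
                  ((r ⊓ s ⊓ t).classCard x : ℝ)⁻¹ * (t.classCard a : ℝ)⁻¹ := by
                  rw [Finset.sum_filter]
                  refine Finset.sum_congr rfl fun x _ => ?_
                  by_cases h1 : (r ⊓ t) a x
                  · by_cases h2 : (s ⊓ t) b x
                    · rw [t.classCard_congr h1.2]; simp [h1, h2]
                    · simp [h2]
                  · simp [h1]
              _ ≤ 1 * (t.classCard a : ℝ)⁻¹ := by
                  rw [← Finset.sum_mul]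
                  refine mul_le_mul_of_nonneg_right ?_ (by positivity)
                  -- For fixed a and b, the admissible x all lie in one class of `r ⊓ s ⊓ t`.
                  refine sum_inv_classCard_le_one _ _ fun x hx y hy => ?_
                  simp only [Finset.mem_filter, Finset.mem_univ, true_and] at hx hy
                  exact ⟨⟨r.trans (r.symm hx.1.1) hy.1.1, s.trans (s.symm hx.2.1) hy.2.1⟩,
                    t.trans (t.symm hx.1.2) hy.1.2⟩
              _ = _ := one_mul _
          · rw [if_neg hab, zero_mul]
            refine (Finset.sum_eq_zero fun x _ => ?_).le
            by_cases h1 : (r ⊓ t) a x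
            · have h2 : ¬ (s ⊓ t) b x := fun h2 => hab (t.trans h2.2 (t.symm h1.2))
              simp [h2]
            · simp [h1]
      _ = ∑ _a : Ω, (1 : ℝ) := by
          refine Finset.sum_congr rfl fun a _ => ?_
          rw [← Finset.sum_mul, ← hcard, mul_inv_cancel₀ (hp t a).ne']
      _ = _ := by simp
  have hlog : ∑ x, (Real.log ((r ⊓ t).classCard x) + Real.log ((s ⊓ t).classCard x)
      - Real.log ((r ⊓ s ⊓ t).classCard x) - Real.log (t.classCard x)) ≤ 0 := by
    calc _ ≤ ∑ x, (((r ⊓ t).classCard x : ℝ) * (s ⊓ t).classCard x *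
          (((r ⊓ s ⊓ t).classCard x : ℝ)⁻¹ * (t.classCard x : ℝ)⁻¹) - 1) := by
          refine Finset.sum_le_sum fun x _ => ?_
          have h1 := hp (r ⊓ t) x
          have h2 := hp (s ⊓ t) x
          have h3 := hp (r ⊓ s ⊓ t) x
          have h4 := hp t x
          refine le_trans (le_of_eq ?_) (Real.log_le_sub_one_of_pos (by positivity))
          rw [Real.log_mul (by positivity) (by positivity), Real.log_mul h1.ne' h2.ne',
            Real.log_mul (by positivity) (by positivity), Real.log_inv, Real.log_inv]
          ring
      _ ≤ 0 := by
          rw [Finset.sum_sub_distrib]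
          simpa using hsum
  simp only [Finset.sum_sub_distrib, Finset.sum_add_distrib] at hlog
  have := div_nonpos_of_nonpos_of_nonneg hlog hΩ.le
  simp only [sub_div, add_div] at this
  unfold entropy
  linarith

theorem entropy_inf_le [Nonempty Ω] (r s : Setoid Ω) :
    (r ⊓ s).entropy ≤ r.entropy + s.entropy := by
  simpa [entropy_top] using entropy_submodular r s ⊤

theorem entropy_finset_inf_le [Nonempty Ω] {ι : Type*} (T : Finset ι) (r : ι → Setoid Ω) :
    (T.inf r).entropy ≤ ∑ i ∈ T, (r i).entropy := by
  classical
  induction T using Finset.induction_on with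
  | empty => simp [entropy_top]
  | insert a T ha ih =>
    rw [Finset.inf_insert, Finset.sum_insert ha]
    exact (entropy_inf_le _ _).trans (by gcongr)

/-- The increments of conditional entropy along a linear order, restricted to a subfamily, bound
the conditional entropy of that subfamily from below. -/
theorem sum_increment_le_entropy {ι : Type*} [LinearOrder ι] [LocallyFiniteOrderBot ι]
    (z : ι → Setoid Ω) (t : Setoid Ω) (T : Finset ι) :
    ∑ i ∈ T, (((Finset.Iic i).inf z ⊓ t).entropy - ((Finset.Iio i).inf z ⊓ t).entropy) ≤
      (T.inf z ⊓ t).entropy - t.entropy := by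
  induction T using Finset.induction_on_max with
  | empty => simp
  | insert a T ha ih =>
    have hmem : a ∉ T := fun h => lt_irrefl _ (ha a h)
    rw [Finset.sum_insert hmem, Finset.inf_insert]
    have hle : (Finset.Iio a).inf z ≤ T.inf z := Finset.inf_mono fun x hx => by
      simpa using ha x hx
    -- Conditioning `z a` on all predecessors of `a`, which include `T`, can only shrink its
    -- increment.
    have h := entropy_submodular (z a) ((Finset.Iio a).inf z) (T.inf z ⊓ t)
    have e1 : (Finset.Iio a).inf z ⊓ (T.inf z ⊓ t) = (Finset.Iio a).inf z ⊓ t := by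
      rw [← inf_assoc, inf_eq_left.2 hle]
    have e2 : z a ⊓ (Finset.Iio a).inf z = (Finset.Iic a).inf z := by
      rw [← Finset.inf_insert, Finset.Iio_insert]
    rw [inf_assoc, e1, ← inf_assoc, e2, ← inf_assoc] at h
    linarith

/-- The chain rule: the increments telescope over initial segments. -/
theorem sum_increment_eq {n : ℕ} (z : Fin n → Setoid Ω) (t : Setoid Ω) :
    ∑ i, (((Finset.Iic i).inf z ⊓ t).entropy - ((Finset.Iio i).inf z ⊓ t).entropy) =
      (Finset.univ.inf z ⊓ t).entropy - t.entropy := by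
  let g : ℕ → ℝ := fun m => ((Finset.univ.filter fun i : Fin n => i.val < m).inf z ⊓ t).entropy
  have hg : ∀ i : Fin n,
      ((Finset.Iic i).inf z ⊓ t).entropy - ((Finset.Iio i).inf z ⊓ t).entropy
        = g (i.val + 1) - g i.val := by
    intro i
    have h1 : Finset.Iic i = Finset.univ.filter fun k : Fin n => k.val < i.val + 1 := by
      ext k; simp only [Finset.mem_Iic, Finset.mem_filter, Finset.mem_univ, true_and]; omega
    have h2 : Finset.Iio i = Finset.univ.filter fun k : Fin n => k.val < i.val := by
      ext k; simp only [Finset.mem_Iio, Finset.mem_filter, Finset.mem_univ, true_and]; omega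
    rw [h1, h2]
  rw [Finset.sum_congr rfl fun i _ => hg i,
    Fin.sum_univ_eq_sum_range (fun m => g (m + 1) - g m) n, Finset.sum_range_sub]
  simp [g]

end Setoid

/-! ### Cyclic windows and the entropy inequality for caches. -/

/-- The cyclic window of `s` consecutive elements of `Fin n` that starts at `j`. -/
def Fin.window {n : ℕ} (s : ℕ) (j : Fin n) : Finset (Fin n) :=
  Finset.univ.filter fun i => (i - j).val < s

theorem Fin.sum_sum_window {n s : ℕ} (hs : s ≤ n) (a : Fin n → ℝ) :
    ∑ j, ∑ i ∈ Fin.window s j, a i = s * ∑ i, a i := by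
  rcases Nat.eq_zero_or_pos n with rfl | hn
  · simp
  have : NeZero n := ⟨hn.ne'⟩
  have hcount : ∀ i : Fin n, (∑ j : Fin n, if (i - j).val < s then (1 : ℝ) else 0) = s := by
    intro i
    have := Equiv.sum_comp (Equiv.subLeft i) (fun k : Fin n => if k.val < s then (1 : ℝ) else 0)
    simp only [Equiv.subLeft_apply] at this
    rw [this, Fin.sum_univ_eq_sum_range (fun m => if m < s then (1 : ℝ) else 0) n, Finset.sum_ite]
    have : (Finset.range n).filter (fun m => m < s) = Finset.range s := by
      ext m; simp; omega
    simp [this]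
  calc _ = ∑ j : Fin n, ∑ i : Fin n, a i * (if (i - j).val < s then (1 : ℝ) else 0) := by
        simp [Fin.window, Finset.sum_filter]
    _ = ∑ i : Fin n, a i * s := by
        rw [Finset.sum_comm]
        exact Finset.sum_congr rfl fun i _ => by rw [← Finset.mul_sum, hcount]
    _ = _ := by rw [← Finset.sum_mul, mul_comm]

/-- Shearer's inequality for cyclic windows. -/
theorem Setoid.entropy_window {Ω : Type*} [Fintype Ω] {n s : ℕ} (hs : s ≤ n)
    (z : Fin n → Setoid Ω) (t : Setoid Ω) :
    s * ((Finset.univ.inf z ⊓ t).entropy - t.entropy) ≤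
      ∑ j, (((Fin.window s j).inf z ⊓ t).entropy - t.entropy) := by
  rw [← sum_increment_eq, ← Fin.sum_sum_window hs]
  exact Finset.sum_le_sum fun j _ => sum_increment_le_entropy z t _

/-- An entropy form of the cut-set bound. The caches `z` of a window together with the transmissions
`x j` determine `A`, all the caches together with `x j` and `U` determine everything, and so do `A`
and `B`. -/
theorem Setoid.log_card_le_of_windows {Ω : Type*} [Fintype Ω] [Nonempty Ω] {n s : ℕ} (hs : s ≤ n)
    (z x : Fin n → Setoid Ω) (A B U : Setoid Ω) {C : ℝ}
    (hA : ∀ j, (Fin.window s j).inf z ⊓ x j ≤ A)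
    (hU : ∀ j, Finset.univ.inf z ⊓ x j ⊓ U ≤ ⊥) (hB : A ⊓ B ≤ ⊥) (hx : ∀ j, (x j).entropy ≤ C) :
    n * Real.log (Fintype.card Ω) ≤
      s * ∑ i, (z i).entropy + n * C + ((n : ℝ) - s) * B.entropy + n * U.entropy := by
  set Z := Finset.univ.inf z with hZ
  have hwin : ∀ j, Real.log (Fintype.card Ω) ≤ ∑ i ∈ Fin.window s j, (z i).entropy + C + U.entropy +
      (Z ⊓ A).entropy - A.entropy - (((Fin.window s j).inf z ⊓ A).entropy - A.entropy) := by
    intro j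
    set S := (Fin.window s j).inf z with hS
    have h1 : Real.log (Fintype.card Ω) ≤ (Z ⊓ x j).entropy + U.entropy := by
      rw [← entropy_bot]
      exact (entropy_anti (hU j)).trans (entropy_inf_le _ _)
    have h2 := entropy_submodular Z (x j) (S ⊓ A)
    have hZS : Z ≤ S := Finset.inf_mono (Finset.subset_univ _)
    -- `Z` and `x j` already determine `S` and `A`, so adjoining them costs nothing.
    have e1 : (Z ⊓ x j).entropy = (Z ⊓ x j ⊓ (S ⊓ A)).entropy := by
      congr 1
      refine le_antisymm (le_inf le_rfl (le_inf (inf_le_left.trans hZS) ?_)) inf_le_left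
      exact (inf_le_inf_right _ hZS).trans (hA j)
    have e2 : Z ⊓ (S ⊓ A) = Z ⊓ A := by rw [← inf_assoc, inf_eq_left.2 hZS]
    have e3 : (x j ⊓ (S ⊓ A)).entropy ≤ (S ⊓ x j).entropy := by
      have hle : S ⊓ x j ≤ x j ⊓ (S ⊓ A) := le_inf inf_le_right (le_inf inf_le_left (hA j))
      rw [le_antisymm (le_inf (inf_le_right.trans inf_le_left) inf_le_left) hle]
    have e4 : (S ⊓ x j).entropy ≤ ∑ i ∈ Fin.window s j, (z i).entropy + C :=
      (entropy_inf_le _ _).trans (add_le_add (entropy_finset_inf_le _ _) (hx j))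
    rw [e2] at h2
    linarith
  have hsum := Finset.sum_le_sum fun j (_ : j ∈ Finset.univ) => hwin j
  have hwindow := entropy_window hs z A
  have hZA : (Z ⊓ A).entropy - A.entropy ≤ B.entropy := by
    have h1 : (Z ⊓ A).entropy ≤ (⊥ : Setoid Ω).entropy := entropy_anti bot_le
    have h2 : (⊥ : Setoid Ω).entropy ≤ A.entropy + B.entropy :=
      (entropy_anti hB).trans (entropy_inf_le _ _)
    linarith
  have hns : (0 : ℝ) ≤ (n : ℝ) - s := sub_nonneg.2 (by exact_mod_cast hs)
  have hmul := mul_le_mul_of_nonneg_left hZA hns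
  simp only [Finset.sum_sub_distrib, Finset.sum_add_distrib, Fin.sum_sum_window hs,
    Finset.sum_const, Finset.card_univ, Fintype.card_fin, nsmul_eq_mul] at hsum hwindow
  linarith

/-! ### From codes to entropies on the good libraries. -/

namespace CodedCaching

theorem log_floor_two_rpow_le {x : ℝ} (h : 0 < ⌊(2 : ℝ) ^ x⌋₊) :
    Real.log (⌊(2 : ℝ) ^ x⌋₊ : ℝ) ≤ x * Real.log 2 := by
  rw [← Real.log_rpow two_pos]
  exact Real.log_le_log (by exact_mod_cast h) (Nat.floor_le (by positivity))

theorem entropy_ker_le_of_floor {Ω : Type*} [Fintype Ω] [Nonempty Ω] {x : ℝ}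
    (f : Ω → Fin ⌊(2 : ℝ) ^ x⌋₊) : (Setoid.ker f).entropy ≤ x * Real.log 2 := by
  have h := Setoid.entropy_ker_le f
  rw [Fintype.card_fin] at h
  -- A value of `f` shows that the alphabet is nonempty. For x < 0 the floor is 0, and the
  -- convention log 0 = 0 would break the bound.
  exact h.trans (log_floor_two_rpow_le (f (Classical.arbitrary Ω)).pos)

theorem card_filter_not_lt (N a : ℕ) :
    (Finset.univ.filter fun f : Fin N => ¬ f.val < a).card = N - a := by
  have h := Finset.card_filter_add_card_filter_not (s := (Finset.univ : Finset (Fin N)))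
    (fun f : Fin N => f.val < a)
  rw [Fin.card_filter_val_lt] at h
  simp only [Finset.card_univ, Fintype.card_fin] at h
  omega

/-- Among the first `n` users, the one at cyclic distance `t` from `j` requests file `t * l + q`;
all other requests are irrelevant. -/
def windowDemand {N K n : ℕ} (hN : 1 ≤ N) (l : ℕ) (j : Fin n) (q : ℕ) : Demand N K := fun k =>
  if h : ∃ hk : k.val < n, ((⟨k.val, hk⟩ : Fin n) - j).val * l + q < N then
    ⟨((⟨k.val, h.1⟩ : Fin n) - j).val * l + q, h.2⟩ else ⟨0, hN⟩

/-- The libraries that are decoded without error whatever the demands. -/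
abbrev Code.Good {N K F : ℕ} {M : Fin K → ℝ} {R : ℝ} (c : Code N K F M R) : Type :=
  {W : Library N F // ∀ d, W ∉ c.errorEvent d}

open scoped Classical in
theorem Code.log_card_good_le {N K F : ℕ} {M : Fin K → ℝ} {R : ℝ} (c : Code N K F M R)
    [Nonempty c.Good] (hN : 1 ≤ N) {n s l : ℕ} (hs : s ≤ n) (hn : n ≤ K) (hl : 1 ≤ l) :
    n * Real.log (Fintype.card c.Good) ≤
      (s * ∑ i : Fin n, M (Fin.castLE hn i) + n * (l * R) + ((n : ℝ) - s) * (N - s * l : ℕ)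
        + n * (N - n * l : ℕ)) * (F * Real.log 2) := by
  let z : Fin n → Setoid c.Good := fun i => Setoid.ker fun w => c.cache (Fin.castLE hn i) w.1
  let x : Fin n → Setoid c.Good := fun j => (Finset.univ : Finset (Fin l)).inf fun q =>
    Setoid.ker fun w => c.encode w.1 (windowDemand hN l j q)
  let file : Fin N → Setoid c.Good := fun f => Setoid.ker fun w => w.1 f
  have hz : ∀ i, (z i).entropy ≤ M (Fin.castLE hn i) * F * Real.log 2 := fun i =>
    entropy_ker_le_of_floor _
  have hx : ∀ j, (x j).entropy ≤ l * (R * F * Real.log 2) := by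
    intro j
    refine (Setoid.entropy_finset_inf_le _ _).trans ?_
    refine (Finset.sum_le_sum fun q _ => entropy_ker_le_of_floor _).trans ?_
    simp
  have hfile : ∀ a : ℕ, ((Finset.univ.filter fun f : Fin N => ¬ f.val < a).inf file).entropy ≤
      (N - a : ℕ) * (F * Real.log 2) := by
    intro a
    refine (Setoid.entropy_finset_inf_le _ _).trans ?_
    rw [← card_filter_not_lt N a, ← nsmul_eq_mul]
    refine Finset.sum_le_card_nsmul _ _ _ fun f _ => ?_
    refine (Setoid.entropy_ker_le _).trans (le_of_eq ?_)
    simp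
  have hdec : ∀ (m : ℕ), m ≤ n → ∀ (j : Fin n) (f : Fin N), f.val < m * l →
      (Fin.window m j).inf z ⊓ x j ≤ file f := by
    intro m hm j f hf
    have : NeZero n := ⟨by have := j.isLt; omega⟩
    have ht : f.val / l < m := Nat.div_lt_of_lt_mul (by rwa [mul_comm] at hf)
    -- Files come in blocks of length l: file f is requested by the user at cyclic distance f / l
    -- from j, in transmission f % l.
    let i : Fin n := j + ⟨f.val / l, ht.trans_le hm⟩
    let q : Fin l := ⟨f.val % l, Nat.mod_lt _ hl⟩
    have hij : (i - j).val = f.val / l := by simp [i]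
    have hiw : i ∈ Fin.window m j := by simp [Fin.window, hij, ht]
    have hval : (i - j).val * l + q.val = f.val := by rw [hij]; exact Nat.div_add_mod' _ _
    have hdem : (windowDemand hN l j q : Demand N K) (Fin.castLE hn i) = f := by
      have h : ∃ hk : (Fin.castLE hn i).val < n,
          ((⟨(Fin.castLE hn i).val, hk⟩ : Fin n) - j).val * l + q.val < N :=
        ⟨i.isLt, hval.trans_lt f.isLt⟩
      rw [windowDemand, dif_pos h]
      exact Fin.ext hval
    have hzi : (Fin.window m j).inf z ≤ z i := Finset.inf_le hiw
    have hxq : x j ≤ Setoid.ker fun w => c.encode w.1 (windowDemand hN l j q) :=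
      Finset.inf_le (Finset.mem_univ q)
    intro w w' hw
    have h1 : c.cache (Fin.castLE hn i) w.1 = c.cache (Fin.castLE hn i) w'.1 := hzi hw.1
    have h2 : c.encode w.1 (windowDemand hN l j q) = c.encode w'.1 (windowDemand hN l j q) :=
      hxq hw.2
    have hgood : ∀ v : c.Good, c.decode (Fin.castLE hn i) (c.cache (Fin.castLE hn i) v.1)
        (c.encode v.1 (windowDemand hN l j q)) (windowDemand hN l j q) = v.1 f := by
      intro v
      have := v.2 (windowDemand hN l j q)
      simp only [errorEvent, Set.mem_ofPred_eq, not_exists, not_not] at this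
      rw [this, hdem]
    show w.1 f = w'.1 f
    rw [← hgood w, ← hgood w', h1, h2]
  have hbot : ∀ r : Setoid c.Good, (∀ f, r ≤ file f) → r ≤ ⊥ := by
    intro r hr w w' hw
    show w = w'
    exact Subtype.ext (funext fun f => hr f hw)
  have hmain := Setoid.log_card_le_of_windows hs z x
    ((Finset.univ.filter fun f : Fin N => f.val < s * l).inf file)
    ((Finset.univ.filter fun f : Fin N => ¬ f.val < s * l).inf file)
    ((Finset.univ.filter fun f : Fin N => ¬ f.val < n * l).inf file)
    (fun j => Finset.le_inf fun f hf => hdec s hs j f (by simpa using hf))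
    (fun j => hbot _ fun f => by
      by_cases hf : f.val < n * l
      · refine inf_le_left.trans ((inf_le_inf_right _ ?_).trans (hdec n le_rfl j f hf))
        exact Finset.inf_mono (Finset.subset_univ _)
      · exact inf_le_right.trans (Finset.inf_le (by simpa using hf)))
    (hbot _ fun f => by
      by_cases hf : f.val < s * l
      · exact inf_le_left.trans (Finset.inf_le (by simpa using hf))
      · exact inf_le_right.trans (Finset.inf_le (by simpa using hf)))
    hx
  refine hmain.trans ?_
  have hns : (0 : ℝ) ≤ (n : ℝ) - s := sub_nonneg.2 (by exact_mod_cast hs)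
  calc _ ≤ s * ∑ i, M (Fin.castLE hn i) * F * Real.log 2 + n * (l * (R * F * Real.log 2))
        + ((n : ℝ) - s) * ((N - s * l : ℕ) * (F * Real.log 2))
        + n * ((N - n * l : ℕ) * (F * Real.log 2)) := by
        gcongr
        · exact hz _
        · exact hfile _
        · exact hfile _
    _ = _ := by
        simp only [mul_assoc, ← Finset.sum_mul]
        ring

theorem libraryLaw_real_singleton (N F : ℕ) (W : Library N F) :
    (libraryLaw N F).real {W} = ((2 : ℝ) ^ (N * F))⁻¹ := by
  rw [Measure.real, libraryLaw, Measure.pi_singleton]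
  simp [← pow_mul, mul_comm]

instance (N F : ℕ) : IsProbabilityMeasure (libraryLaw N F) := by
  unfold libraryLaw; infer_instance

open scoped Classical in
theorem Code.card_good_ge {N K F : ℕ} {M : Fin K → ℝ} {R : ℝ} (c : Code N K F M R)
    [Nonempty (Demand N K)]
    (h : c.errorProb < 1 / (2 * Fintype.card (Demand N K))) :
    (2 : ℝ) ^ (N * F) ≤ 2 * Fintype.card c.Good := by
  have hc : (0 : ℝ) < Fintype.card (Demand N K) := by exact_mod_cast Fintype.card_pos
  have hev : ∀ d, (libraryLaw N F).real (c.errorEvent d) ≤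
      1 / (2 * Fintype.card (Demand N K)) := fun d =>
    (le_ciSup (f := fun d => (libraryLaw N F).real (c.errorEvent d)) (Set.finite_range _).bddAbove
      d).trans h.le
  let G : Set (Library N F) := {W | ∀ d, W ∉ c.errorEvent d}
  have hG : Gᶜ = ⋃ d, c.errorEvent d := by ext W; simp [G]
  have h1 : (libraryLaw N F).real Gᶜ ≤ 1 / 2 := by
    rw [hG]
    refine (measureReal_iUnion_fintype_le _).trans
      ((Finset.sum_le_sum fun d _ => hev d).trans (le_of_eq ?_))
    rw [Finset.sum_const, nsmul_eq_mul, Finset.card_univ]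
    field_simp
  have h2 : (libraryLaw N F).real G = Fintype.card c.Good * ((2 : ℝ) ^ (N * F))⁻¹ := by
    have e : G = ((Finset.univ.filter fun W => W ∈ G : Finset (Library N F)) : Set _) := by
      ext; simp
    rw [e, ← sum_measureReal_singleton]
    simp only [libraryLaw_real_singleton, Finset.sum_const, nsmul_eq_mul]
    rw [Fintype.card_subtype]
    rfl
  rw [probReal_compl_eq_one_sub (Set.toFinite _).measurableSet, h2] at h1
  have hp : (0 : ℝ) < 2 ^ (N * F) := by positivity
  have : 1 / 2 ≤ (Fintype.card c.Good : ℝ) / 2 ^ (N * F) := by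
    rw [div_eq_mul_inv (Fintype.card c.Good : ℝ)]; linarith
  rw [le_div_iff₀ hp] at this
  linarith

/-! ### Passage to the limit and the rate bound. -/

theorem le_of_achievable {N K : ℕ} {M : Fin K → ℝ} {R : ℝ} (hN : 1 ≤ N) (hR : Achievable N M R)
    {n s l : ℕ} (hs : s ≤ n) (hn : n ≤ K) (hl : 1 ≤ l) :
    (n : ℝ) * N ≤ s * ∑ i : Fin n, M (Fin.castLE hn i) + n * (l * R)
      + ((n : ℝ) - s) * (N - s * l : ℕ) + n * (N - n * l : ℕ) := by
  classical
  set Q := s * ∑ i : Fin n, M (Fin.castLE hn i) + n * (l * R)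
      + ((n : ℝ) - s) * (N - s * l : ℕ) + n * (N - n * l : ℕ) with hQ
  have : Nonempty (Demand N K) := ⟨fun _ => ⟨0, hN⟩⟩
  have hc : (0 : ℝ) < Fintype.card (Demand N K) := by exact_mod_cast Fintype.card_pos
  -- The slack n / F is the single bit lost by keeping only half of the libraries, counted n times.
  have hev : ∀ᶠ F : ℕ in atTop, (n : ℝ) * N - n / F ≤ Q := by
    filter_upwards [hR (1 / (2 * Fintype.card (Demand N K))) (by positivity), eventually_ge_atTop 1]
      with F ⟨c, hcF⟩ hF
    have hF0 : (0 : ℝ) < F := by exact_mod_cast hF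
    have hL : 0 < Real.log 2 := Real.log_pos one_lt_two
    have hcard := c.card_good_ge hcF
    have hpos : (0 : ℝ) < Fintype.card c.Good := by
      have : (0 : ℝ) < 2 ^ (N * F) := by positivity
      linarith
    have : Nonempty c.Good := Fintype.card_pos_iff.1 (by exact_mod_cast hpos)
    have hlog := Real.log_le_log (by positivity) hcard
    rw [Real.log_pow, Real.log_mul two_ne_zero hpos.ne'] at hlog
    push_cast at hlog
    have hmain := c.log_card_good_le hN hs hn hl
    rw [← hQ] at hmain
    have h := mul_le_mul_of_nonneg_left hlog (Nat.cast_nonneg (α := ℝ) n)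
    have h3 : ((n : ℝ) * N - n / F) * (F * Real.log 2) ≤ Q * (F * Real.log 2) := by
      have : ((n : ℝ) * N - n / F) * (F * Real.log 2) =
          n * (N * F * Real.log 2) - n * Real.log 2 := by field_simp
      linarith
    exact le_of_mul_le_mul_right h3 (by positivity)
  have hlim : Tendsto (fun F : ℕ => (n : ℝ) * N - n / F) atTop (nhds ((n : ℝ) * N - 0)) :=
    tendsto_const_nhds.sub (tendsto_const_div_atTop_nhds_zero_nat _)
  simpa using le_of_tendsto hlim hev

theorem boundTerm_le_of_achievable {N K : ℕ} {M : Fin K → ℝ} {R : ℝ} (hN : 1 ≤ N)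
    (hR : Achievable N M R) {s l : ℕ} (hs : 1 ≤ s) (hsK : s ≤ K) (hl : 1 ≤ l) :
    boundTerm N M s l ≤ R := by
  have hn : s + gamma N K s l ≤ K := by unfold gamma; omega
  have h := le_of_achievable hN hR (Nat.le_add_right s (gamma N K s l)) hn hl
  have hl0 : (0 : ℝ) < l := by exact_mod_cast hl
  have hs0 : (0 : ℝ) < s := by exact_mod_cast hs
  have hsub : ∀ a : ℕ, ((N - a : ℕ) : ℝ) = max ((N : ℝ) - a) 0 := by
    intro a
    rcases le_total a N with h | h
    · rw [Nat.cast_sub h, max_eq_left (sub_nonneg.2 (by exact_mod_cast h))]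
    · rw [Nat.sub_eq_zero_of_le h, max_eq_right (sub_nonpos.2 (by exact_mod_cast h)), Nat.cast_zero]
  -- Either the first s + γ users already cover all files, and the left side is 0, or s + γ = K.
  have hrest : N - (s + gamma N K s l) * l ≤ N - K * l := by
    rcases le_total (⌈(N : ℝ) / l⌉₊ - s) (K - s) with hle | hle
    · have h1 : ⌈(N : ℝ) / l⌉₊ ≤ s + gamma N K s l := by
        rw [gamma, min_eq_left hle]; omega
      have h2 : (N : ℝ) ≤ (s + gamma N K s l : ℕ) * l :=
        (div_le_iff₀ hl0).1 (Nat.ceil_le.1 h1)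
      have h3 : N ≤ (s + gamma N K s l) * l := by exact_mod_cast h2
      omega
    · have h1 : s + gamma N K s l = K := by rw [gamma, min_eq_right hle]; omega
      rw [h1]
  have hsum : ∑ i : Fin (s + gamma N K s l), M (Fin.castLE hn i) =
      ∑ i : Fin K with i.val < s + gamma N K s l, M i := by
    refine Finset.sum_bij (fun i _ => Fin.castLE hn i) (fun i _ => by simp)
      (fun a _ b _ hab => by simpa using hab) (fun b hb => ?_) (fun _ _ => rfl)
    simp only [Finset.mem_filter, Finset.mem_univ, true_and] at hb
    exact ⟨⟨b.val, hb⟩, Finset.mem_univ _, rfl⟩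
  have hrest' : ((N - (s + gamma N K s l) * l : ℕ) : ℝ) ≤ max ((N : ℝ) - K * l) 0 := by
    have h1 := hsub (K * l)
    push_cast at h1
    rw [← h1]
    exact_mod_cast hrest
  have hdec := hsub (s * l)
  push_cast at hdec
  rw [hsum, hdec, mul_comm (s : ℝ) l] at h
  unfold boundTerm
  simp only
  set γ := gamma N K s l
  set m := ∑ i : Fin K with i.val < s + γ, M i
  push_cast at h
  have hn0 : (0 : ℝ) < s + γ := by positivity
  have h' := h.trans (add_le_add_right (mul_le_mul_of_nonneg_left hrest' hn0.le) _)
  rw [one_div, inv_mul_le_iff₀ hl0, sub_le_iff_le_add, sub_le_iff_le_add, sub_le_iff_le_add]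
  have e : (l : ℝ) * R + max ((N : ℝ) - K * l) 0 + γ * max ((N : ℝ) - l * s) 0 / (s + γ)
      + s / (s + γ) * m = (s * m + (s + γ) * (l * R) + ((s : ℝ) + γ - s) * max ((N : ℝ) - l * s) 0
        + (s + γ) * max ((N : ℝ) - K * l) 0) / (s + γ) := by
    field_simp
    ring
  rw [e, le_div_iff₀ hn0]
  linarith

/-- Sending the whole library achieves the rate `N`. -/
theorem achievable_card (N : ℕ) {K : ℕ} {M : Fin K → ℝ} (hM : ∀ k, 0 ≤ M k) :
    Achievable N M (N : ℝ) := by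
  intro ε hε
  refine Eventually.of_forall fun F => ?_
  have hcard : Fintype.card (Library N F) = ⌊(2 : ℝ) ^ ((N : ℝ) * F)⌋₊ := by
    have : (2 : ℝ) ^ ((N : ℝ) * F) = ((2 ^ (N * F) : ℕ) : ℝ) := by
      rw [← Nat.cast_mul, Real.rpow_natCast]; push_cast; rfl
    rw [this, Nat.floor_natCast]
    simp [← pow_mul, mul_comm]
  let e : Library N F ≃ Fin ⌊(2 : ℝ) ^ ((N : ℝ) * F)⌋₊ := Fintype.equivFinOfCardEq hcard
  -- Nonnegative capacity leaves room for at least one cache value; a constant cache is enough.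
  have hpos : ∀ k, 0 < ⌊(2 : ℝ) ^ (M k * F)⌋₊ := fun k =>
    Nat.floor_pos.2 (Real.one_le_rpow one_le_two (mul_nonneg (hM k) (Nat.cast_nonneg _)))
  refine ⟨⟨fun k _ => ⟨0, hpos k⟩, fun W _ => e W, fun k _ x d => e.symm x (d k)⟩, ?_⟩
  simp [Code.errorProb, Code.errorEvent, hε]

end CodedCaching

theorem theorem2 (N K : ℕ) (hN : 1 ≤ N) (hK : 1 ≤ K) (M : Fin K → ℝ)
    (hM_nonneg : ∀ k, 0 ≤ M k) (hM_lt : ∀ k, M k < N) (hM_mono : Monotone M) :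
    IsGLB {R : ℝ | CodedCaching.Achievable N M R} (CodedCaching.optimalRate N M) ∧
      CodedCaching.lowerBoundRate N hN hK M ≤ CodedCaching.optimalRate N M := by
  have hne : {R : ℝ | CodedCaching.Achievable N M R}.Nonempty :=
    ⟨N, CodedCaching.achievable_card N hM_nonneg⟩
  have hlower : CodedCaching.lowerBoundRate N hN hK M ∈
      lowerBounds {R : ℝ | CodedCaching.Achievable N M R} := by
    intro R hR
    refine Finset.sup'_le _ _ fun p hp => ?_
    simp only [CodedCaching.boundIndices, Finset.mem_sigma, Finset.mem_Icc] at hp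
    exact CodedCaching.boundTerm_le_of_achievable hN hR hp.1.1 hp.1.2 hp.2.1
  exact ⟨isGLB_csInf hne ⟨_, hlower⟩, le_csInf hne hlower⟩
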